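/- Let $f_c(z)=z^2+c\in\mathbb{Z}[c][z]$, and let $f_c^{\circ k}$ denote its $k$-th iterate, with $f_c^{\circ 0}(z)=z$ and $f_c^{\circ k}=f_c\circ f_c^{\circ(k-1)}$. For a positive integer $n$, the $n$-th dynatomic polynomial is $$\Phi_n^*(z,c)=\prod_{d\mid n}\bigl(f_c^{\circ d}(z)-z\bigr)^{\mu(n/d)},$$ and the $n$-th multiplier polynomial $\delta_n(x,c)$ is the polynomial, monic in $x$, that satisfies $$\delta_n(x,c)^n=\operatorname{Res}_z\bigl(\Phi_n^*(z,c),\,x-(f_c^{\circ n})'(z)\bigr).$$ Let $\operatorname{cyc}_j(x)$ denote the $j$-th cyclotomic polynomial. For positive integers $m\mid n$ the delta factor $\Delta_{n,m}(c)$ is defined as follows: if $m<n$, then $$\Delta_{n,m}(c)=\operatorname{Res}_x\bigl(\operatorname{cyc}_{n/m}(x),\,\delta_m(x,c)\bigr);$$ if $m=n$, then $\Delta_{n,n}(c)$ is defined by $$\delta_n(1,c)=\Delta_{n,n}(c)\prod_{d\mid n,\ d\neq n}\Delta_{n,d}(c).$$ Theorem. For every positive integer $k$, the polynomial $\Delta_{3k,3}(c)$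 is irreducible over $\mathbb{Q}$. -/

import Mathlib

open Polynomial

/-!
Conventions: a polynomial in the parameter `c` is an element of `ℚ[X]`. Elements of `ℚ[X][X]`
are polynomials in `z` (for `quadMap`, `quadIter`, `dynatomic`) or in `x` (for the multiplier
polynomials) whose coefficients are polynomials in `c`.
-/

noncomputable section

/-- The family `f_c(z) = z ^ 2 + c`, as a polynomial in `z` over `ℚ[c]`. -/
def quadMap : ℚ[X][X] := X ^ 2 + C X

/-- The `k`-th iterate of `f_c`: the `0`-th one is `z`, and the `k`-th one is `f_c` composed with
the `(k - 1)`-st one. -/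
def quadIter : ℕ → ℚ[X][X]
  | 0 => X
  | k + 1 => quadMap.comp (quadIter k)

/-- The `n`-th dynatomic polynomial `∏_{k ∣ n} (f_c^k(z) - z) ^ μ(n / k)`. The factors with
exponent `-1` are monic in `z` when `n` is positive, and the product of those with exponent `1`
is divided by their product. -/
def dynatomic (n : ℕ) : ℚ[X][X] :=
  (∏ k ∈ n.divisors with ArithmeticFunction.moebius (n / k) = 1, (quadIter k - X)) /ₘ
    (∏ k ∈ n.divisors with ArithmeticFunction.moebius (n / k) = -1, (quadIter k - X))

/-- The resultant with respect to `z` of `Φ_n^*(z, c)` and `x - (f_c^n)'(z)`, a polynomial in `x`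
over `ℚ[c]`. The two arguments are polynomials in `z` over `ℚ[c][x]`. -/
def multiplierResultant (n : ℕ) : ℚ[X][X] :=
  resultant ((dynatomic n).map C) (C X - (derivative (quadIter n)).map C)

/-- `δ` is monic in `x` and its `n`-th power is the resultant that collects the multipliers of
the roots of the `n`-th dynatomic polynomial. -/
def IsMultiplierPolynomial (n : ℕ) (δ : ℚ[X][X]) : Prop :=
  δ.Monic ∧ δ ^ n = multiplierResultant n

theorem IsMultiplierPolynomial.unique {n : ℕ} (hn : 0 < n) {δ ε : ℚ[X][X]}
    (hδ : IsMultiplierPolynomial n δ) (hε : IsMultiplierPolynomial n ε) : δ = ε := by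
  obtain ⟨h1, h2⟩ := hδ
  obtain ⟨h3, h4⟩ := hε
  have hpow : δ ^ n = ε ^ n := h2.trans h4.symm
  have hdeg : δ.natDegree = ε.natDegree := by
    have h := congrArg natDegree hpow
    rw [h1.natDegree_pow, h3.natDegree_pow] at h
    exact Nat.eq_of_mul_eq_mul_left hn h
  have hsum : ∑ i ∈ Finset.range n, δ ^ i * ε ^ (n - 1 - i) ≠ 0 := by
    intro h0
    have h := congrArg (fun p => coeff p ((n - 1) * ε.natDegree)) h0
    simp only [finsetSum_coeff, coeff_zero] at h
    have h5 : ∀ i ∈ Finset.range n,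
        (δ ^ i * ε ^ (n - 1 - i)).coeff ((n - 1) * ε.natDegree) = 1 := by
      intro i hi
      have hm : (δ ^ i * ε ^ (n - 1 - i)).Monic := (h1.pow i).mul (h3.pow _)
      have hd : (δ ^ i * ε ^ (n - 1 - i)).natDegree = (n - 1) * ε.natDegree := by
        rw [(h1.pow i).natDegree_mul (h3.pow _), h1.natDegree_pow, h3.natDegree_pow, hdeg,
          ← add_mul]
        congr 1
        have := Finset.mem_range.mp hi
        omega
      rw [← hd]
      exact hm.coeff_natDegree
    rw [Finset.sum_congr rfl h5] at h
    simp at h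
    omega
  have h6 := (Commute.all δ ε).geom_sum₂_mul n
  rw [hpow, sub_self] at h6
  exact sub_eq_zero.mp ((mul_eq_zero.mp h6).resolve_left hsum)

open Classical in
/-- The `n`-th multiplier polynomial `δ_n(x, c)`: the monic polynomial in `x` over `ℚ[c]` whose
`n`-th power is `multiplierResultant n`. -/
def multiplierPolynomial (n : ℕ) : ℚ[X][X] :=
  if h : ∃ δ : ℚ[X][X], IsMultiplierPolynomial n δ then h.choose else 0

theorem multiplierPolynomial_eq {n : ℕ} (hn : 0 < n) {δ : ℚ[X][X]}
    (hδ : IsMultiplierPolynomial n δ) : multiplierPolynomial n = δ := by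
  have h : ∃ δ : ℚ[X][X], IsMultiplierPolynomial n δ := ⟨δ, hδ⟩
  rw [multiplierPolynomial, dif_pos h]
  exact h.choose_spec.unique hn hδ

/-- The delta factor `Δ_{n,m}(c)` for positive integers `m ∣ n`. For `m < n` it is the resultant
with respect to `x` of the `(n / m)`-th cyclotomic polynomial and `δ_m(x, c)`. For `m = n` it is the
quotient of `δ_n(1, c)` by the product of the `Δ_{n,d}(c)` over the divisors `d ≠ n` of `n`. -/
def deltaFactor (n m : ℕ) : ℚ[X] :=
  if m = n then
    (multiplierPolynomial n).eval 1 /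
      ∏ d ∈ n.properDivisors, resultant (cyclotomic (n / d) ℚ[X]) (multiplierPolynomial d)
  else
    resultant (cyclotomic (n / m) ℚ[X]) (multiplierPolynomial m)

end

/-! Substituting c = -(s² + s + 2) defines each of the two 3-cycles over ℚ(s). They are exchanged by
s ↦ -1 - s, which is t ↦ -t for t = -2s - 1, and one of them has multiplier P(t) = t³ - t² + 7t + 1.
For k ≥ 2 the delta factor becomes cyc_k(P(t)) cyc_k(P(-t)), so it suffices that cyc_k ∘ P is
irreducible and does not divide its reflection (`irreducible_of_comp_quadratic_eq_mul`).
Irreducibility means that P - ζ has no root in ℚ(ζ) (`cubic_ne_rootOfUnity`): |P(t)| = 1 in every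
embedding makes certain algebraic integers built from t and its conjugate so small that they vanish.
Non-divisibility holds because |P(t)| = |P(-t)| = 1 forces t = 0, where P = 1. For k = 1 the factor
is 4c + 7. -/

/-! ### Complex estimates for the cubic P -/

theorem period_three_re_bound {a b : ℝ}
    (h : (a ^ 2 + b ^ 2) * ((a ^ 2 - a + 7 - b ^ 2) ^ 2 + b ^ 2 * (2 * a - 1) ^ 2) ≤ 4) :
    4 * a ^ 2 - 2 * a - 1 < 0 := by
  by_contra! hc
  obtain ⟨B, hB⟩ : ∃ B, B = b ^ 2 := ⟨_, rfl⟩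
  have hB0 : 0 ≤ B := hB ▸ sq_nonneg b
  rw [← hB] at h
  have hQ : (a ^ 2 - a + 7 - B) ^ 2 + B * (2 * a - 1) ^ 2
      = (B + (a ^ 2 - a) + 7) ^ 2 - 27 * B := by ring
  rw [hQ] at h
  -- 4/5 and -3/10 are rational weakenings of the roots (1 ± √5)/4 of 4a² - 2a - 1. Each case ends
  -- in a cubic inequality in `B`.
  rcases le_total 0 a with ha | ha
  · have ha1 : 4 / 5 < a := by nlinarith
    have hm : -(4 / 25) ≤ a ^ 2 - a := by nlinarith
    have h1 : (B + 171 / 25) ^ 2 ≤ (B + (a ^ 2 - a) + 7) ^ 2 :=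
      pow_le_pow_left₀ (by linarith) (by linarith) 2
    have h2 : 0 ≤ (B + 171 / 25) ^ 2 - 27 * B := by nlinarith [sq_nonneg (B - 333 / 50)]
    have h3 : (16 / 25 + B) * ((B + 171 / 25) ^ 2 - 27 * B) ≤ 4 := by
      refine le_trans (mul_le_mul ?_ ?_ h2 ?_) h
      · nlinarith
      · linarith
      · positivity
    nlinarith [mul_nonneg hB0 (sq_nonneg (B - 63 / 10)), sq_nonneg (B - 63 / 10)]
  · have ha1 : a ≤ -(3 / 10) := by nlinarith
    have ha2 : 19 / 200 ≤ a ^ 2 := by nlinarith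
    have hm : 39 / 100 ≤ a ^ 2 - a := by nlinarith
    have h1 : (B + 739 / 100) ^ 2 ≤ (B + (a ^ 2 - a) + 7) ^ 2 :=
      pow_le_pow_left₀ (by linarith) (by linarith) 2
    have h2 : 0 ≤ (B + 739 / 100) ^ 2 - 27 * B := by nlinarith [sq_nonneg (B - 611 / 100)]
    have h3 : (19 / 200 + B) * ((B + 739 / 100) ^ 2 - 27 * B) ≤ 4 := by
      refine le_trans (mul_le_mul ?_ ?_ h2 ?_) h
      · linarith
      · linarith
      · positivity
    nlinarith [mul_nonneg hB0 (sq_nonneg (B - 6)), sq_nonneg (B - 6)]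

theorem re_bound_of_norm_eq_one {t : ℂ} (h : ‖t ^ 3 - t ^ 2 + 7 * t + 1‖ = 1) :
    4 * t.re ^ 2 - 2 * t.re - 1 < 0 := by
  apply period_three_re_bound (b := t.im)
  have h1 : ‖t * (t ^ 2 - t + 7)‖ ≤ 2 := by
    calc ‖t * (t ^ 2 - t + 7)‖ = ‖(t ^ 3 - t ^ 2 + 7 * t + 1) - 1‖ := by ring_nf
      _ ≤ ‖t ^ 3 - t ^ 2 + 7 * t + 1‖ + ‖(1 : ℂ)‖ := norm_sub_le _ _
      _ = 2 := by rw [h]; norm_num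
  have h2 : Complex.normSq (t * (t ^ 2 - t + 7)) ≤ 4 := by
    rw [Complex.normSq_eq_norm_sq]
    nlinarith [norm_nonneg (t * (t ^ 2 - t + 7))]
  refine le_trans (le_of_eq ?_) h2
  simp [Complex.normSq_apply, pow_two]
  ring

/-- The parallelogram law for P(±t) = (1 - t²) ± t(t² + 7) gives, with w = t², 2 Re w = |w|² +
|t|²|w + 7|². Hence Re w ≥ 0, so the right side is at least 49|t|², while Re w ≤ |t|². -/
theorem eq_zero_of_norm_eq_one_of_norm_neg_eq_one {t : ℂ}
    (h : ‖t ^ 3 - t ^ 2 + 7 * t + 1‖ = 1)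
    (h' : ‖(-t) ^ 3 - (-t) ^ 2 + 7 * (-t) + 1‖ = 1) : t = 0 := by
  have hsum : Complex.normSq (1 - t ^ 2) + Complex.normSq t * Complex.normSq (t ^ 2 + 7) = 1 := by
    have h1 : Complex.normSq (t ^ 3 - t ^ 2 + 7 * t + 1) = 1 := by
      rw [Complex.normSq_eq_norm_sq, h]; norm_num
    have h2 : Complex.normSq ((-t) ^ 3 - (-t) ^ 2 + 7 * (-t) + 1) = 1 := by
      rw [Complex.normSq_eq_norm_sq, h']; norm_num
    have h3 : t ^ 3 - t ^ 2 + 7 * t + 1 = (1 - t ^ 2) + t * (t ^ 2 + 7) := by ring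
    have h4 : (-t) ^ 3 - (-t) ^ 2 + 7 * (-t) + 1 = (1 - t ^ 2) - t * (t ^ 2 + 7) := by ring
    rw [h3, Complex.normSq_add, map_mul] at h1
    rw [h4, Complex.normSq_sub, map_mul] at h2
    linarith
  have hw : Complex.normSq (t ^ 2) = Complex.normSq t ^ 2 := map_pow _ _ _
  obtain ⟨w, hwt⟩ : ∃ w, w = t ^ 2 := ⟨_, rfl⟩
  rw [← hwt] at hsum hw
  obtain ⟨r, hr⟩ : ∃ r, r = Complex.normSq t := ⟨_, rfl⟩
  rw [← hr] at hsum hw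
  have hr0 : 0 ≤ r := hr ▸ Complex.normSq_nonneg t
  simp only [Complex.normSq_apply, Complex.sub_re, Complex.add_re, Complex.sub_im, Complex.add_im,
    Complex.one_re, Complex.one_im, Complex.re_ofNat, Complex.im_ofNat] at hsum hw
  have hle : w.re ≤ r := by nlinarith [mul_self_nonneg w.im]
  have hwre : 0 ≤ w.re := by
    nlinarith [mul_nonneg hr0 (add_nonneg (mul_self_nonneg (w.re + 7)) (mul_self_nonneg (w.im + 0)))]
  have h49 : r * 49 ≤ r * ((w.re + 7) * (w.re + 7) + (w.im + 0) * (w.im + 0)) :=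
    mul_le_mul_of_nonneg_left (by nlinarith [mul_self_nonneg w.im]) hr0
  have : r = 0 := by nlinarith
  exact Complex.normSq_eq_zero.mp (hr ▸ this)

/-! ### Roots of unity as values of P -/

theorem NumberField.eq_zero_of_forall_norm_lt_one {K : Type*} [Field K] [NumberField K] {a : K}
    (ha : IsIntegral ℤ a) (h : ∀ σ : K →+* ℂ, ‖σ a‖ < 1) : a = 0 := by
  by_contra h0
  obtain ⟨w⟩ : Nonempty (NumberField.InfinitePlace K) := inferInstance
  let b : NumberField.RingOfIntegers K := ⟨a, ha⟩
  have hb : b ≠ 0 := fun hb => h0 (congrArg Subtype.val hb)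
  have key : ∀ z : NumberField.InfinitePlace K, z b < 1 := by
    intro z
    rw [← z.norm_embedding_eq]
    exact h _
  exact absurd (NumberField.InfinitePlace.one_le_of_lt_one hb fun z _ => key z) (key w).not_ge

/-- A root of unity of order at least two is not the value of `t ^ 3 - t ^ 2 + 7 * t + 1` at an
element of the field it generates: `x = t + conj t` would satisfy `|x * (x - 1)| < 1` in every
embedding, so that `x = 0` or `x = 1`. -/
theorem cubic_ne_rootOfUnity {K : Type*} [Field K] [NumberField K] {k : ℕ} (hk : 2 ≤ k) {ζ : K}
    (hζ : IsPrimitiveRoot ζ k) (hgen : ∀ y : K, ∃ q : ℚ[X], y = aeval ζ q) (t : K) :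
    t ^ 3 - t ^ 2 + 7 * t + 1 ≠ ζ := by
  intro ht
  have hζ1 : ζ ≠ 1 := hζ.ne_one hk
  have hζ0 : ζ ≠ 0 := hζ.ne_zero (by omega)
  have ht0 : t ≠ 0 := by
    rintro rfl
    exact hζ1 (by simpa using ht.symm)
  obtain ⟨q, hq⟩ := hgen t
  -- `u` is the complex conjugate of `t` in every embedding, since conjugation inverts roots of
  -- unity.
  obtain ⟨u, hu⟩ : ∃ u, u = aeval ζ⁻¹ q := ⟨_, rfl⟩
  have hnorm (σ : K →+* ℂ) : ‖σ ζ‖ = 1 :=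
    (hζ.map_of_injective σ.injective).norm'_eq_one (by omega)
  have hconj (σ : K →+* ℂ) : σ u = starRingEnd ℂ (σ t) := by
    have h1 : σ u = aeval (σ ζ⁻¹) q := by
      rw [hu]; exact (aeval_algHom_apply σ.toRatAlgHom ζ⁻¹ q).symm
    have h2 : σ t = aeval (σ ζ) q := by
      rw [hq]; exact (aeval_algHom_apply σ.toRatAlgHom ζ q).symm
    have h3 : starRingEnd ℂ (aeval (σ ζ) q) = aeval (starRingEnd ℂ (σ ζ)) q :=
      (aeval_algHom_apply (starRingEnd ℂ).toRatAlgHom (σ ζ) q).symm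
    rw [h1, h2, h3, map_inv₀, Complex.inv_eq_conj (hnorm σ)]
  obtain ⟨σ₀⟩ : Nonempty (K →+* ℂ) := inferInstance
  have hPu : u ^ 3 - u ^ 2 + 7 * u + 1 = ζ⁻¹ := by
    apply σ₀.injective
    rw [map_inv₀, Complex.inv_eq_conj (hnorm σ₀), ← ht]
    simp [hconj, map_ofNat]
  have hint {y z : K} (hz : IsIntegral ℤ z) (hy : y ^ 3 - y ^ 2 + 7 * y + 1 = z) :
      IsIntegral ℤ y := by
    have hm : (X ^ 3 - X ^ 2 + 7 * X + 1 : ℤ[X]).Monic := by monicity!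
    have hd : (X ^ 3 - X ^ 2 + 7 * X + 1 : ℤ[X]).natDegree = 3 := by compute_degree!
    exact IsIntegral.of_aeval_monic hm (by rw [hd]; norm_num) (by simpa [hy, map_ofNat] using hz)
  have hti : IsIntegral ℤ t := hint (hζ.isIntegral (by omega)) ht
  have hui : IsIntegral ℤ u := hint (hζ.inv.isIntegral (by omega)) hPu
  have hx : (t + u) * (t + u - 1) = 0 := by
    apply NumberField.eq_zero_of_forall_norm_lt_one
    · exact (hti.add hui).mul ((hti.add hui).sub isIntegral_one)
    · intro σ
      have hb := re_bound_of_norm_eq_one (t := σ t) (by rw [← hnorm σ, ← ht]; simp [map_ofNat])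
      have h1 : σ ((t + u) * (t + u - 1))
          = ((2 * (σ t).re * (2 * (σ t).re - 1) : ℝ) : ℂ) := by
        rw [map_mul, map_sub, map_add, hconj, Complex.add_conj]
        push_cast
        simp
      rw [h1, Complex.norm_real, Real.norm_eq_abs, abs_lt]
      constructor
      · nlinarith [sq_nonneg (4 * (σ t).re - 1)]
      · nlinarith
  have hmul : (t ^ 3 - t ^ 2 + 7 * t + 1) * (u ^ 3 - u ^ 2 + 7 * u + 1) = 1 := by
    rw [ht, hPu, mul_inv_cancel₀ hζ0]
  rcases mul_eq_zero.mp hx with h0 | h1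
  · obtain rfl : u = -t := eq_neg_of_add_eq_zero_right h0
    have h2 := congrArg σ₀ ht
    have h3 := congrArg σ₀ hPu
    refine ht0 (σ₀.injective ?_)
    rw [map_zero]
    apply eq_zero_of_norm_eq_one_of_norm_neg_eq_one
    · rw [← hnorm σ₀, ← h2]; simp [map_ofNat]
    · have : ‖σ₀ ζ⁻¹‖ = 1 := by rw [map_inv₀, norm_inv, hnorm, inv_one]
      rw [← this, ← h3]; simp [map_ofNat]
  · obtain rfl : u = 1 - t := by linear_combination h1
    -- With N = t(1 - t), P(t)P(1 - t) - 1 is a polynomial in N, and P(t) - 1 = -t(N - 7).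
    have h7 : (t * (1 - t) - 7) * ((t * (1 - t)) * (t * (1 - t) - 7) - 1) = 0 := by
      linear_combination hmul
    rcases mul_eq_zero.mp h7 with h2 | h2
    · exact hζ1 (by rw [← ht]; linear_combination (-t) * h2)
    -- N is |t|² ≥ 0 in every embedding, so N(N - 7) = 1 forces 0 < N - 7 < 1.
    · have h3 : t * (1 - t) - 7 = 0 := by
        apply NumberField.eq_zero_of_forall_norm_lt_one
        · refine (hti.mul hui).sub ?_
          simpa [map_ofNat] using isIntegral_algebraMap (R := ℤ) (A := K) (x := 7)
        · intro σ
          have h4 : σ (t * (1 - t)) = (Complex.normSq (σ t) : ℂ) := by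
            rw [map_mul, hconj, Complex.mul_conj]
          have h5 := congrArg σ h2
          rw [map_sub, map_mul, map_sub, h4, map_ofNat, map_one, map_zero] at h5
          have h6 : Complex.normSq (σ t) * (Complex.normSq (σ t) - 7) - 1 = 0 := by
            exact_mod_cast h5
          rw [map_sub, h4, map_ofNat, ← Complex.ofReal_ofNat, ← Complex.ofReal_sub,
            Complex.norm_real, Real.norm_eq_abs, abs_lt]
          have := Complex.normSq_nonneg (σ t)
          constructor <;> nlinarith
      rw [h3] at h2
      simp at h2

/-! ### Irreducibility of cyc_k ∘ P -/

theorem irreducible_cubic_sub_C_rootOfUnity {K : Type*} [Field K] [CharZero K]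
    [A : Algebra ℚ K] [FiniteDimensional ℚ K] {k : ℕ} (hk : 2 ≤ k) {ζ : K}
    (hζ : minpoly ℚ ζ = cyclotomic k ℚ) (hgen : ∀ y : K, ∃ q : ℚ[X], y = aeval ζ q) :
    Irreducible ((X ^ 3 - X ^ 2 + 7 * X + 1 : ℚ[X]).map (algebraMap ℚ K) - C ζ) := by
  obtain rfl : A = DivisionRing.toRatAlgebra := Subsingleton.elim _ _
  have : NumberField K := ⟨⟩
  have : NeZero (k : K) := ⟨by exact_mod_cast (by omega : k ≠ 0)⟩
  have hprim : IsPrimitiveRoot ζ k := by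
    rw [← isRoot_cyclotomic_iff, ← map_cyclotomic k (algebraMap ℚ _), IsRoot.def,
      eval_map_algebraMap, ← hζ]
    exact minpoly.aeval _ _
  have hmap : (X ^ 3 - X ^ 2 + 7 * X + 1 : ℚ[X]).map (algebraMap ℚ K) - C ζ
      = X ^ 3 - X ^ 2 + 7 * X + (1 - C ζ) := by
    simp [Polynomial.map_ofNat]; ring
  rw [hmap]
  apply irreducible_of_degree_le_three_of_not_isRoot
  · have : (X ^ 3 - X ^ 2 + 7 * X + (1 - C ζ)).natDegree = 3 := by
      compute_degree!
    rw [this]; simp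
  · intro t ht
    apply cubic_ne_rootOfUnity hk hprim hgen t
    simp [IsRoot.def] at ht
    linear_combination ht

theorem IntermediateField.AdjoinSimple.exists_eq_aeval_gen {F E : Type*} [Field F] [Field E]
    [Algebra F E] {x : E} (hx : IsIntegral F x) (y : IntermediateField.adjoin F {x}) :
    ∃ q : F[X], y = aeval (IntermediateField.AdjoinSimple.gen F x) q := by
  obtain ⟨q, -, hq⟩ := (IntermediateField.adjoin.powerBasis hx).exists_eq_aeval y
  exact ⟨q, hq⟩

/-- Capelli's criterion: for f irreducible with root x, f ∘ P is irreducible once P - x is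
irreducible over ℚ(x). -/
theorem irreducible_cyclotomic_comp_cubic {k : ℕ} (hk : 2 ≤ k) :
    Irreducible ((cyclotomic k ℚ).comp (X ^ 3 - X ^ 2 + 7 * X + 1)) := by
  have hm : (X ^ 3 - X ^ 2 + 7 * X + 1 : ℚ[X]).Monic := by monicity!
  refine irreducible_comp (cyclotomic.monic k ℚ) hm (cyclotomic.irreducible_rat (by omega)) ?_
  intro E _ _ x hx
  have hxi : IsIntegral ℚ x := by
    by_contra h
    exact cyclotomic_ne_zero k ℚ (hx.symm.trans (minpoly.eq_zero h))
  have := IntermediateField.adjoin.finiteDimensional hxi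
  refine @irreducible_cubic_sub_C_rootOfUnity _ _ (algebraRat.charZero _)
    (IntermediateField.algebra' _) this k hk _ ?_ ?_
  · rw [IntermediateField.minpoly_gen ℚ x, hx]
  · exact IntermediateField.AdjoinSimple.exists_eq_aeval_gen hxi

/-! ### Descent from s to c -/

theorem Polynomial.irreducible_comp_of_comp_eq_X {R : Type*} [CommRing R] {f p q : R[X]}
    (hf : Irreducible f) (hpq : p.comp q = X) (hqp : q.comp p = X) : Irreducible (f.comp p) := by
  have h : f.comp p = algEquivOfCompEqX p q hpq hqp f := by
    simp [comp_eq_aeval]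
  rw [h]
  exact (MulEquiv.irreducible_iff (algEquivOfCompEqX p q hpq hqp)).mpr hf

theorem comp_comp_neg_one_sub (f : ℚ[X]) :
    (f.comp (-(X ^ 2 + X + 2))).comp (-1 - X) = f.comp (-(X ^ 2 + X + 2)) := by
  rw [comp_assoc]
  congr 1
  simp
  ring

theorem natDegree_neg_quadratic : (-(X ^ 2 + X + 2) : ℚ[X]).natDegree = 2 := by
  rw [natDegree_neg]
  compute_degree!

theorem compRingHom_injective {q : ℚ[X]} (hq : q.natDegree ≠ 0) :
    Function.Injective (compRingHom q) := by
  rw [injective_iff_map_eq_zero]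
  intro f hf
  rw [coe_compRingHom_apply, comp_eq_zero_iff] at hf
  refine hf.resolve_right fun h => hq ?_
  rw [h.2, natDegree_C]

theorem comp_quadratic_injective :
    Function.Injective (compRingHom (-(X ^ 2 + X + 2) : ℚ[X])) :=
  compRingHom_injective (by rw [natDegree_neg_quadratic]; norm_num)

/-- If `D(-(s^2+s+2))` is the product of an irreducible polynomial and its reflection in
`s ↦ -1 - s`, and these are not associated, then `D` is irreducible. -/
theorem irreducible_of_comp_quadratic_eq_mul {D E : ℚ[X]} (hE : Irreducible E)
    (hD : D.comp (-(X ^ 2 + X + 2)) = E * E.comp (-1 - X)) (hne : ¬ E ∣ E.comp (-1 - X)) :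
    Irreducible D := by
  have hinv : (-1 - X : ℚ[X]).comp (-1 - X) = X := by simp
  have hE' : Irreducible (E.comp (-1 - X)) := irreducible_comp_of_comp_eq_X hE hinv hinv
  have hcop : IsCoprime E (E.comp (-1 - X)) := (hE.coprime_iff_not_dvd).mpr hne
  have hunit {f : ℚ[X]} (hf : IsUnit (f.comp (-(X ^ 2 + X + 2)))) : IsUnit f := by
    have h1 := natDegree_eq_zero_of_isUnit hf
    rw [natDegree_comp, natDegree_neg_quadratic] at h1
    rw [isUnit_iff_degree_eq_zero, degree_eq_natDegree]
    · exact_mod_cast (by omega : f.natDegree = 0)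
    · rintro rfl
      simp at hf
  -- The pullback of `A` is invariant under the reflection, so it is divisible by both coprime
  -- factors, which leaves a unit for `B`.
  have key {A B : ℚ[X]} (hAB : D = A * B) (hA : E ∣ A.comp (-(X ^ 2 + X + 2))) : IsUnit B := by
    have hA' : E.comp (-1 - X) ∣ A.comp (-(X ^ 2 + X + 2)) := by
      obtain ⟨F, hF⟩ := hA
      refine ⟨F.comp (-1 - X), ?_⟩
      rw [← mul_comp, ← hF, comp_comp_neg_one_sub]
    obtain ⟨F, hF⟩ := hcop.mul_dvd hA hA'
    apply hunit
    have h0 : E * E.comp (-1 - X) ≠ 0 := mul_ne_zero hE.ne_zero hE'.ne_zero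
    rw [hAB, mul_comp, hF] at hD
    refine IsUnit.of_mul_eq_one_right (a := F) ?_
    apply mul_left_cancel₀ h0
    linear_combination hD
  refine ⟨fun hu => ?_, fun A B hAB => ?_⟩
  · have h1 : IsUnit (D.comp (-(X ^ 2 + X + 2))) := by
      obtain ⟨r, hr, rfl⟩ := Polynomial.isUnit_iff.mp hu
      simpa using hu
    rw [hD] at h1
    exact hE.not_isUnit (isUnit_of_mul_isUnit_left h1)
  · have h1 : E ∣ A.comp (-(X ^ 2 + X + 2)) * B.comp (-(X ^ 2 + X + 2)) := by
      rw [← mul_comp, ← hAB, hD]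
      exact dvd_mul_right _ _
    rcases hE.prime.dvd_or_dvd h1 with h | h
    · exact Or.inr (key hAB h)
    · exact Or.inl (key (hAB.trans (mul_comm _ _)) h)

theorem irreducible_cyclotomic_comp_multiplier {k : ℕ} (hk : 2 ≤ k) :
    Irreducible ((cyclotomic k ℚ).comp (-8 * (X ^ 3 + 2 * X ^ 2 + 3 * X + 1))) := by
  have h : (-8 * (X ^ 3 + 2 * X ^ 2 + 3 * X + 1) : ℚ[X])
      = (X ^ 3 - X ^ 2 + 7 * X + 1).comp (-2 * X - 1) := by
    simp
    ring
  have hC : (2 : ℚ[X]) * C (1 / 2) = 1 := by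
    rw [← C_ofNat, ← C_mul]
    norm_num
  rw [h, ← comp_assoc]
  refine irreducible_comp_of_comp_eq_X (q := -C (1 / 2) * (X + 1))
    (irreducible_cyclotomic_comp_cubic hk) ?_ ?_
  · simp only [sub_comp, mul_comp, neg_comp, ofNat_comp, X_comp, one_comp]
    linear_combination (X + 1) * hC
  · simp only [add_comp, mul_comp, neg_comp, C_comp, X_comp, one_comp]
    linear_combination X * hC

theorem not_dvd_cyclotomic_comp_multiplier_reflection {k : ℕ} (hk : 2 ≤ k) :
    ¬ (cyclotomic k ℚ).comp (-8 * (X ^ 3 + 2 * X ^ 2 + 3 * X + 1)) ∣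
      ((cyclotomic k ℚ).comp (-8 * (X ^ 3 + 2 * X ^ 2 + 3 * X + 1))).comp (-1 - X) := by
  intro hdvd
  have hirr := irreducible_cyclotomic_comp_multiplier hk
  obtain ⟨s, hs⟩ := IsAlgClosed.exists_aeval_eq_zero ℂ _ hirr.degree_pos.ne'
  have hs' := aeval_eq_zero_of_dvd_aeval_eq_zero hdvd hs
  have : NeZero (k : ℂ) := ⟨by exact_mod_cast (by omega : k ≠ 0)⟩
  have hroot {z : ℂ} (hz : aeval z (cyclotomic k ℚ) = 0) : IsPrimitiveRoot z k := by
    rwa [← isRoot_cyclotomic_iff, ← map_cyclotomic k (algebraMap ℚ _), IsRoot.def,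
      eval_map_algebraMap]
  rw [aeval_comp] at hs
  rw [aeval_comp, aeval_comp] at hs'
  have h1 := hroot hs
  have h2 := hroot hs'
  have e1 : aeval s (-8 * (X ^ 3 + 2 * X ^ 2 + 3 * X + 1) : ℚ[X])
      = (-2 * s - 1) ^ 3 - (-2 * s - 1) ^ 2 + 7 * (-2 * s - 1) + 1 := by
    simp [map_ofNat]; ring
  have e2 : aeval (aeval s (-1 - X : ℚ[X])) (-8 * (X ^ 3 + 2 * X ^ 2 + 3 * X + 1) : ℚ[X])
      = (-(-2 * s - 1)) ^ 3 - (-(-2 * s - 1)) ^ 2 + 7 * (-(-2 * s - 1)) + 1 := by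
    simp [map_ofNat]; ring
  rw [e1] at h1
  rw [e2] at h2
  have ht := eq_zero_of_norm_eq_one_of_norm_neg_eq_one (h1.norm'_eq_one (by omega))
    (h2.norm'_eq_one (by omega))
  rw [ht] at h1
  exact h1.ne_one hk (by norm_num)

theorem irreducible_of_comp_quadratic_eq_cyclotomic_mul {k : ℕ} (hk : 2 ≤ k) {D : ℚ[X]}
    (hD : D.comp (-(X ^ 2 + X + 2)) =
      (cyclotomic k ℚ).comp (-8 * (X ^ 3 + 2 * X ^ 2 + 3 * X + 1)) *
      ((cyclotomic k ℚ).comp (-8 * (X ^ 3 + 2 * X ^ 2 + 3 * X + 1))).comp (-1 - X)) :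
    Irreducible D :=
  irreducible_of_comp_quadratic_eq_mul (irreducible_cyclotomic_comp_multiplier hk) hD
    (not_dvd_cyclotomic_comp_multiplier_reflection hk)

/-! ### Resultants -/

theorem resultant_C_add_mul {R : Type*} [CommRing R] {G : R[X]} (hG : G.Monic) (H : R[X]) (r : R)
    {n : ℕ} (hn : H.natDegree + G.natDegree ≤ n) :
    resultant G (C r + G * H) G.natDegree n = r ^ G.natDegree := by
  rw [resultant_add_mul_right _ _ _ _ _ hn le_rfl, resultant_C_right, coeff_natDegree,
    hG.leadingCoeff, one_pow, one_mul]

/-- The two linear factors contribute the same sign, so the signs cancel. -/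
theorem comp_resultant_cyclotomic (n : ℕ) {q a b : ℚ[X]} {δ : ℚ[X][X]} (hdeg : δ.natDegree = 2)
    (h : δ.map (compRingHom q) = (X - C a) * (X - C b)) :
    (resultant (cyclotomic n ℚ[X]) δ).comp q = (cyclotomic n ℚ).comp a * (cyclotomic n ℚ).comp b := by
  have heval (r : ℚ[X]) : eval r (cyclotomic n ℚ[X]) = (cyclotomic n ℚ).comp r := by
    rw [← map_cyclotomic n (C : ℚ →+* ℚ[X]), eval_map, comp]
  have h2 : δ.natDegree = (X - C a).natDegree + (X - C b).natDegree := by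
    rw [hdeg, natDegree_X_sub_C, natDegree_X_sub_C]
  rw [← coe_compRingHom_apply, ← resultant_map_map, map_cyclotomic, h, h2,
    resultant_mul_right _ _ _ _ le_rfl, natDegree_X_sub_C, natDegree_X_sub_C,
    resultant_X_sub_C_right _ _ _ le_rfl, resultant_X_sub_C_right _ _ _ le_rfl, heval, heval,
    mul_mul_mul_comm, ← mul_pow]
  simp

/-! ### The two 3-cycles -/

/-- The cubic in `z` whose roots form the `3`-cycle with sum `s` of `z ^ 2 + c`, where
`c = -(s ^ 2 + s + 2)`. -/
noncomputable def threeCycle {R : Type*} [CommRing R] (s : R) : R[X] :=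
  X ^ 3 - C s * X ^ 2 - C (s ^ 2 + 2 * s + 3) * X + C (s ^ 3 + 2 * s ^ 2 + 3 * s + 1)

section threeCycle

variable {R : Type*} [CommRing R] (s : R)

theorem monic_threeCycle : (threeCycle s).Monic := by
  unfold threeCycle
  monicity!

theorem natDegree_threeCycle [Nontrivial R] : (threeCycle s).natDegree = 3 := by
  unfold threeCycle
  compute_degree!

/-- The product is Φ₃*; its z⁵ coefficient is 1, so the two cycle sums add up to -1. -/
theorem threeCycle_mul_threeCycle {c : R} (hc : c = -(s ^ 2 + s + 2)) :
    threeCycle s * threeCycle (-1 - s) = X ^ 6 + X ^ 5 + (3 * C c + 1) * X ^ 4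
      + (2 * C c + 1) * X ^ 3 + (3 * C c ^ 2 + 3 * C c + 1) * X ^ 2
      + (C c ^ 2 + 2 * C c + 1) * X + (C c ^ 3 + 2 * C c ^ 2 + C c + 1) := by
  subst hc
  simp only [threeCycle, map_add, map_mul, map_pow, map_neg, map_sub, map_one, map_ofNat]
  ring

/-- On the cycle z f(z) f²(z) is the product of its points, so the multiplier is constant modulo the
cubic; hence a cube. The formal degree 7 is kept even if 8 vanishes in `R`. -/
theorem resultant_threeCycle [Nontrivial R] {c : R} (hc : c = -(s ^ 2 + s + 2)) (x : R) :
    resultant (threeCycle s) (C x - 8 * X * (X ^ 2 + C c) * ((X ^ 2 + C c) ^ 2 + C c))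
      (threeCycle s).natDegree 7 = (x + 8 * (s ^ 3 + 2 * s ^ 2 + 3 * s + 1)) ^ 3 := by
  have hH : C x - 8 * X * (X ^ 2 + C c) * ((X ^ 2 + C c) ^ 2 + C c)
      = C (x + 8 * (s ^ 3 + 2 * s ^ 2 + 3 * s + 1)) + threeCycle s *
        (-(8 * X ^ 4 + 8 * C s * X ^ 3 - 8 * C (s ^ 2 + s + 3) * X ^ 2
          - 8 * C (s ^ 3 + s ^ 2 + 3 * s + 1) * X + 8)) := by
    subst hc
    simp only [threeCycle, map_add, map_mul, map_pow, map_neg, map_one, map_ofNat]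
    ring
  have hdeg : (-(8 * X ^ 4 + 8 * C s * X ^ 3 - 8 * C (s ^ 2 + s + 3) * X ^ 2
          - 8 * C (s ^ 3 + s ^ 2 + 3 * s + 1) * X + 8)).natDegree ≤ 4 := by
    rw [natDegree_neg]
    compute_degree
  rw [hH, resultant_C_add_mul (monic_threeCycle s), natDegree_threeCycle]
  rw [natDegree_threeCycle]
  omega

end threeCycle

/-! ### Multiplier polynomials for periods 3 and 1 -/

theorem quadIter_one : quadIter 1 = X ^ 2 + C X := by
  simp [quadIter, quadMap]

theorem quadIter_three : quadIter 3 = ((X ^ 2 + C X) ^ 2 + C X) ^ 2 + C X := by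
  simp [quadIter, quadMap]

theorem moebius_three_div_filter_one :
    {k ∈ Nat.divisors 3 | ArithmeticFunction.moebius (3 / k) = 1} = ({3} : Finset ℕ) := by
  rw [show Nat.divisors 3 = {1, 3} from rfl]
  simp [Finset.filter_insert, Finset.filter_singleton,
    ArithmeticFunction.moebius_apply_prime Nat.prime_three]

theorem moebius_three_div_filter_neg_one :
    {k ∈ Nat.divisors 3 | ArithmeticFunction.moebius (3 / k) = -1} = ({1} : Finset ℕ) := by
  rw [show Nat.divisors 3 = {1, 3} from rfl]
  simp [Finset.filter_insert, Finset.filter_singleton,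
    ArithmeticFunction.moebius_apply_prime Nat.prime_three]

theorem dynatomic_three : dynatomic 3 = X ^ 6 + X ^ 5 + (3 * C X + 1) * X ^ 4
      + (2 * C X + 1) * X ^ 3 + (3 * C X ^ 2 + 3 * C X + 1) * X ^ 2
      + (C X ^ 2 + 2 * C X + 1) * X + (C X ^ 3 + 2 * C X ^ 2 + C X + 1) := by
  have hm : (quadIter 1 - X).Monic := by
    rw [quadIter_one]
    monicity!
  rw [dynatomic, moebius_three_div_filter_one, moebius_three_div_filter_neg_one,
    Finset.prod_singleton, Finset.prod_singleton]
  refine Eq.trans ?_ (mul_divByMonic_cancel_left _ hm)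
  congr 1
  rw [quadIter_one, quadIter_three]
  ring

theorem dynatomic_one : dynatomic 1 = X ^ 2 - X + C X := by
  simp [dynatomic, Finset.filter_singleton, quadIter_one]
  ring

/-- The multiplier polynomial `δ_3(x, c)`. -/
noncomputable def deltaThree : ℚ[X][X] :=
  X ^ 2 - C (16 + 8 * X) * X + C (64 * (X ^ 3 + 2 * X ^ 2 + X + 1))

/-- The multiplier polynomial `δ_1(x, c)`. -/
noncomputable def deltaOne : ℚ[X][X] := X ^ 2 - 2 * X + C (4 * X)

theorem natDegree_deltaThree : deltaThree.natDegree = 2 := by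
  unfold deltaThree
  compute_degree!

theorem natDegree_deltaOne : deltaOne.natDegree = 2 := by
  unfold deltaOne
  compute_degree!

theorem deltaThree_map : deltaThree.map (compRingHom (-(X ^ 2 + X + 2))) =
    (X - C (-8 * (X ^ 3 + 2 * X ^ 2 + 3 * X + 1))) *
      (X - C ((-8 * (X ^ 3 + 2 * X ^ 2 + 3 * X + 1) : ℚ[X]).comp (-1 - X))) := by
  simp [deltaThree, map_ofNat]
  ring

theorem deltaOne_map : deltaOne.map (compRingHom (X - X ^ 2)) =
    (X - C (2 * X)) * (X - C (2 - 2 * X)) := by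
  simp [deltaOne, Polynomial.map_ofNat, map_ofNat]
  ring

/-- The identity is checked after the injective substitution c = -(s² + s + 2), where each cycle
contributes the cube of a linear factor in x. -/
theorem isMultiplierPolynomial_three : IsMultiplierPolynomial 3 deltaThree := by
  refine ⟨by unfold deltaThree; monicity!, ?_⟩
  apply map_injective _ comp_quadratic_injective
  have hd : derivative (quadIter 3) = 8 * X * (X ^ 2 + C X) * ((X ^ 2 + C X) ^ 2 + C X) := by
    rw [quadIter_three]
    simp [derivative_pow, map_ofNat]
    ring
  have hf : ((dynatomic 3).map (C : ℚ[X] →+* ℚ[X][X])).natDegree = 6 := by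
    rw [natDegree_map_eq_of_injective C_injective, dynatomic_three]
    compute_degree!
  have hg : (C X - (derivative (quadIter 3)).map (C : ℚ[X] →+* ℚ[X][X])).natDegree = 7 := by
    rw [natDegree_sub, natDegree_sub_C, natDegree_map_eq_of_injective C_injective, hd]
    compute_degree!
  have hc : (C (-(X ^ 2 + X + 2)) : ℚ[X][X]) = -(C X ^ 2 + C X + 2) := by simp [map_ofNat]
  have hc' : (C (-(X ^ 2 + X + 2)) : ℚ[X][X]) = -((-1 - C X) ^ 2 + (-1 - C X) + 2) := by
    rw [hc]
    ring
  have hfm : ((dynatomic 3).map C).map (mapRingHom (compRingHom (-(X ^ 2 + X + 2) : ℚ[X])))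
      = threeCycle (C X : ℚ[X][X]) * threeCycle (-1 - C X : ℚ[X][X]) := by
    rw [threeCycle_mul_threeCycle _ hc, dynatomic_three]
    simp [Polynomial.map_ofNat]
  have hgm : (C X - (derivative (quadIter 3)).map C).map
      (mapRingHom (compRingHom (-(X ^ 2 + X + 2) : ℚ[X])))
      = C X - 8 * X * (X ^ 2 + C (C (-(X ^ 2 + X + 2)))) *
        ((X ^ 2 + C (C (-(X ^ 2 + X + 2)))) ^ 2 + C (C (-(X ^ 2 + X + 2)))) := by
    rw [hd]
    simp [Polynomial.map_ofNat]
  have hgd : (C X - 8 * X * (X ^ 2 + C (C (-(X ^ 2 + X + 2)))) *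
        ((X ^ 2 + C (C (-(X ^ 2 + X + 2)))) ^ 2 + C (C (-(X ^ 2 + X + 2)))) :
          ℚ[X][X][X]).natDegree ≤ 7 := by
    rw [← hgm, ← hg]
    exact natDegree_map_le
  have h6 : 6 = (threeCycle (C X : ℚ[X][X])).natDegree
      + (threeCycle (-1 - C X : ℚ[X][X])).natDegree := by
    rw [natDegree_threeCycle, natDegree_threeCycle]
  rw [multiplierResultant, ← coe_mapRingHom, ← resultant_map_map, hf.trans h6, hg, hfm, hgm,
    resultant_mul_left _ _ _ _ hgd, resultant_threeCycle _ hc, resultant_threeCycle _ hc',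
    coe_mapRingHom, Polynomial.map_pow, deltaThree_map, mul_pow]
  congr 2
  · simp [map_ofNat]
  · simp [map_ofNat]

/-- With c = p - p² the fixed points are p and 1 - p. -/
theorem comp_X_sub_sq_injective : Function.Injective (compRingHom (X - X ^ 2 : ℚ[X])) :=
  compRingHom_injective (by rw [show (X - X ^ 2 : ℚ[X]).natDegree = 2 by compute_degree!]; norm_num)

theorem isMultiplierPolynomial_one : IsMultiplierPolynomial 1 deltaOne := by
  refine ⟨by unfold deltaOne; monicity!, ?_⟩
  apply map_injective _ comp_X_sub_sq_injective
  have hd : derivative (quadIter 1) = 2 * X := by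
    rw [quadIter_one]
    simp
    norm_num
  have hf : ((dynatomic 1).map (C : ℚ[X] →+* ℚ[X][X])).natDegree = 2 := by
    rw [natDegree_map_eq_of_injective C_injective, dynatomic_one]
    compute_degree!
  have hg : (C X - (derivative (quadIter 1)).map (C : ℚ[X] →+* ℚ[X][X])).natDegree = 1 := by
    rw [natDegree_sub, natDegree_sub_C, natDegree_map_eq_of_injective C_injective, hd]
    compute_degree!
  have hfm : ((dynatomic 1).map C).map (mapRingHom (compRingHom (X - X ^ 2 : ℚ[X])))
      = (X - C (C X)) * (X - C (1 - C X)) := by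
    rw [dynatomic_one]
    simp
    ring
  have hgm : (C X - (derivative (quadIter 1)).map C).map
      (mapRingHom (compRingHom (X - X ^ 2 : ℚ[X]))) = C X - 2 * X := by
    rw [hd]
    simp [Polynomial.map_ofNat]
  have hgd : (C X - 2 * X : ℚ[X][X][X]).natDegree ≤ 1 := by
    compute_degree
  have h2 : 2 = (X - C (C X) : ℚ[X][X][X]).natDegree
      + (X - C (1 - C X) : ℚ[X][X][X]).natDegree := by
    rw [natDegree_X_sub_C, natDegree_X_sub_C]
  rw [multiplierResultant, ← coe_mapRingHom, ← resultant_map_map, hf, hg, hfm, hgm, h2,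
    resultant_mul_left _ _ _ _ hgd, natDegree_X_sub_C, natDegree_X_sub_C,
    resultant_X_sub_C_left _ _ _ hgd, resultant_X_sub_C_left _ _ _ hgd, pow_one,
    coe_mapRingHom, deltaOne_map]
  simp only [eval_sub, eval_mul, eval_X, eval_C, eval_ofNat, map_sub, map_mul, map_ofNat]
  ring

theorem resultant_cyclotomic_three_deltaOne :
    resultant (cyclotomic 3 ℚ[X]) deltaOne = 16 * X ^ 2 + 4 * X + 7 := by
  apply comp_X_sub_sq_injective
  rw [coe_compRingHom_apply, coe_compRingHom_apply,
    comp_resultant_cyclotomic 3 natDegree_deltaOne deltaOne_map, cyclotomic_three]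
  simp
  ring

theorem irreducible_four_mul_X_add_seven : Irreducible (4 * X + 7 : ℚ[X]) := by
  have : (4 * X + 7 : ℚ[X]).degree = 1 := by compute_degree!
  exact irreducible_of_degree_eq_one this

theorem theorem1p2 (k : ℕ) (hk : 0 < k) : Irreducible (deltaFactor (3 * k) 3) := by
  rw [deltaFactor, multiplierPolynomial_eq three_pos isMultiplierPolynomial_three]
  rcases Nat.lt_or_ge 1 k with h | h
  · rw [if_neg (by omega), Nat.mul_div_cancel_left k three_pos]
    apply irreducible_of_comp_quadratic_eq_cyclotomic_mul h
    rw [comp_resultant_cyclotomic k natDegree_deltaThree deltaThree_map, comp_assoc]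
  · obtain rfl : k = 1 := by omega
    -- The quadratic factor is Δ_{3,1}: at its roots a fixed point has a primitive cube root of
    -- unity as multiplier.
    have hfac : deltaThree.eval 1 = (4 * X + 7) * (16 * X ^ 2 + 4 * X + 7) := by
      simp [deltaThree]
      ring
    have hne : (16 * X ^ 2 + 4 * X + 7 : ℚ[X]) ≠ 0 := by
      intro h0
      have := congrArg (eval 0) h0
      simp at this
    rw [if_pos (by norm_num), Nat.mul_one, multiplierPolynomial_eq three_pos
      isMultiplierPolynomial_three, Nat.prime_three.properDivisors, Finset.prod_singleton,
      Nat.div_one, multiplierPolynomial_eq one_pos isMultiplierPolynomial_one,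
      resultant_cyclotomic_three_deltaOne, hfac, mul_div_cancel_right₀ _ hne]
    exact irreducible_four_mul_X_add_seven
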